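/- **Proposition (Monge–Knothe transport for Gaussians).** Let $E\subseteq\mathbb R^d$ be a linear subspace of dimension $k$, with orthogonal complement $E^\perp$, and let $V_E\in\mathbb R^{d\times k}$, $V_{E^\perp}\in\mathbb R^{d\times(d-k)}$ be matrices whose columns are orthonormal bases of $E$ and $E^\perp$; put $V=(V_E\ \ V_{E^\perp})$. Let $\mu=\mathcal N(0,A)$ and $\nu=\mathcal N(0,B)$ with $A,B\in\mathbb R^{d\times d}$ symmetric positive definite, and write $$V^\top A V=\begin{pmatrix}A_E & A_{EE^\perp}\\ A_{EE^\perp}^\top & A_{E^\perp}\end{pmatrix},\qquad V^\top B V=\begin{pmatrix}B_E & B_{EE^\perp}\\ B_{EE^\perp}^\top & B_{E^\perp}\end{pmatrix}.$$ Definitions. A *Monge map* from a probability measure $\alpha$ to a probability measure $\beta$ is a Borel map $T$ with $T_\sharp\alpha=\beta$ that minimizes $\int\|x-T(x)\|^2\,d\alpha(x)$ among all Borel maps pushing $\alpha$ to $\beta$. Denote by $\mu_E$ the image of $\mu$ under the orthogonal projection onto $E$, and by $(\mu_{x_E})_{x_E\in E}$ the disintegration of $\mu$ on $E$, i.e. $\mu_{x_E}$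 is the conditional law on $E^\perp$ of the $E^\perp$-component of $X\sim\mu$ given that its $E$-component is $x_E$; similarly for $\nu$. A *Monge–Knothe (MK) transport map* on $E$ from $\mu$ to $\nu$ is a Borel map of the form $T(x_E+x_{E^\perp})=S(x_E)+\hat T(x_E;x_{E^\perp})$, where $S:E\to E$ is a Monge map from $\mu_E$ to $\nu_E$ and, for $\mu_E$-almost every $x_E$, $\hat T(x_E;\cdot):E^\perp\to E^\perp$ is a Monge map from $\mu_{x_E}$ to $\nu_{S(x_E)}$. For symmetric positive definite $P,Q$ let $T^{PQ}=P^{-1/2}(P^{1/2}QP^{1/2})^{1/2}P^{-1/2}$, and let $A/A_E=A_{E^\perp}-A_{EE^\perp}^\top A_E^{-1}A_{EE^\perp}$ be the Schur complement (similarly $B/B_E$). Claim. The linear map $x\mapsto V\,\mathbf T_{\mathrm{MK}}\,V^\top x$ of $\mathbb R^d$, which is represented in the orthonormal basis $V$ by the lower block-triangular matrix $$\mathbf T_{\mathrm{MK}}=\begin{pmatrix} T^{A_EB_E} & 0_{k\times(d-k)}\\ \left[B_{EE^\perp}^\top (T^{A_EB_E})^{-1}-T^{(A/A_E)(B/B_E)}A_{EE^\perp}^\top\right](A_E)^{-1}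 & T^{(A/A_E)(B/B_E)}\end{pmatrix},$$ is a Monge–Knothe transport map on $E$ from $\mu$ to $\nu$, and every Monge–Knothe transport map on $E$ from $\mu$ to $\nu$ is equal to it $\mu$-almost everywhere. -/

import Mathlib

open MeasureTheory ProbabilityTheory
open scoped MatrixOrder ENNReal

noncomputable section

/-- `T` is a Monge map from `μ` to `ν` for the quadratic cost: it is a Borel map with `T_# μ = ν`,
and it has the least cost `E_{X ∼ μ} ‖X - T X‖²` among all Borel maps that push `μ` to `ν`. -/
structure IsMongeMap {X : Type*} [NormedAddCommGroup X] [MeasurableSpace X]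
    (μ ν : Measure X) (T : X → X) : Prop where
  measurable : Measurable T
  map_eq : μ.map T = ν
  optimal : ∀ T' : X → X, Measurable T' → μ.map T' = ν →
    ∫⁻ x, ‖x - T x‖ₑ ^ 2 ∂μ ≤ ∫⁻ x, ‖x - T' x‖ₑ ^ 2 ∂μ

/-- The marginal `μ_E` of `μ` on the subspace `E`: the push-forward of `μ` by the orthogonal
projection onto `E`. -/
def marginalOn {d : ℕ} (E : Submodule ℝ (EuclideanSpace ℝ (Fin d)))
    (μ : Measure (EuclideanSpace ℝ (Fin d))) : Measure E :=
  μ.map E.orthogonalProjectionOnto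

/-- The disintegration `(μ_{x_E})` of `μ` on the subspace `E`: the conditional law of the component
of `X ∼ μ` in `Eᗮ` given its component in `E`. -/
def disintegrationOn {d : ℕ} (E : Submodule ℝ (EuclideanSpace ℝ (Fin d)))
    (μ : Measure (EuclideanSpace ℝ (Fin d))) [IsFiniteMeasure μ] : Kernel E Eᗮ :=
  condDistrib Eᗮ.orthogonalProjectionOnto E.orthogonalProjectionOnto μ

/-- `T` is a Monge–Knothe transport map on `E` from `μ` to `ν`: a Borel map of the form
`T (x_E + x_{E^⊥}) = S x_E + T̂ (x_E; x_{E^⊥})`, where `S` is a Monge map from `μ_E` to `ν_E` and,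
for `μ_E`-almost every `x_E`, `T̂ (x_E; ·)` is a Monge map from `μ_{x_E}` to `ν_{S x_E}`. -/
def IsMongeKnotheMap {d : ℕ} (E : Submodule ℝ (EuclideanSpace ℝ (Fin d)))
    (μ ν : Measure (EuclideanSpace ℝ (Fin d))) [IsFiniteMeasure μ] [IsFiniteMeasure ν]
    (T : EuclideanSpace ℝ (Fin d) → EuclideanSpace ℝ (Fin d)) : Prop :=
  Measurable T ∧
  ∃ (S : E → E) (That : E → Eᗮ → Eᗮ),
    IsMongeMap (marginalOn E μ) (marginalOn E ν) S ∧
    (∀ᵐ xE ∂(marginalOn E μ),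
      IsMongeMap (disintegrationOn E μ xE) (disintegrationOn E ν (S xE)) (That xE)) ∧
    ∀ x, T x = (S (E.orthogonalProjectionOnto x) : EuclideanSpace ℝ (Fin d)) +
      (That (E.orthogonalProjectionOnto x) (Eᗮ.orthogonalProjectionOnto x) : EuclideanSpace ℝ (Fin d))

/-- The Bures–Monge matrix `T^{AB} = A^{-1/2} (A^{1/2} B A^{1/2})^{1/2} A^{-1/2}`. -/
def buresMonge {n : Type*} [Fintype n] [DecidableEq n] (A B : Matrix n n ℝ) : Matrix n n ℝ :=
  (CFC.sqrt A)⁻¹ * CFC.sqrt (CFC.sqrt A * B * CFC.sqrt A) * (CFC.sqrt A)⁻¹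

/-- The `d × k` matrix whose columns are the vectors of an orthonormal basis of `E`. -/
def basisMatrix {d k : ℕ} {E : Submodule ℝ (EuclideanSpace ℝ (Fin d))}
    (b : OrthonormalBasis (Fin k) ℝ E) : Matrix (Fin d) (Fin k) ℝ :=
  Matrix.of fun i j => (b j : EuclideanSpace ℝ (Fin d)) i

/-- The Schur complement `A / A₁₁ = A₂₂ - A₁₂ᵀ A₁₁⁻¹ A₁₂` of a symmetric block matrix. -/
def schurCompl {m n : Type*} [Fintype m] [DecidableEq m] (A : Matrix (m ⊕ n) (m ⊕ n) ℝ) :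
    Matrix n n ℝ :=
  A.toBlocks₂₂ - A.toBlocks₁₂.transpose * A.toBlocks₁₁⁻¹ * A.toBlocks₁₂

/-- The lower block-triangular Monge–Knothe matrix of two covariance matrices `A`, `B` that are
written in a basis adapted to `E ⊕ Eᗮ`. -/
def mkMatrix {m n : Type*} [Fintype m] [DecidableEq m] [Fintype n] [DecidableEq n]
    (A B : Matrix (m ⊕ n) (m ⊕ n) ℝ) : Matrix (m ⊕ n) (m ⊕ n) ℝ :=
  Matrix.fromBlocks
    (buresMonge A.toBlocks₁₁ B.toBlocks₁₁)
    0
    ((B.toBlocks₁₂.transpose * (buresMonge A.toBlocks₁₁ B.toBlocks₁₁)⁻¹ -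
        buresMonge (schurCompl A) (schurCompl B) * A.toBlocks₁₂.transpose) * A.toBlocks₁₁⁻¹)
    (buresMonge (schurCompl A) (schurCompl B))

end

/-! For symmetric positive definite `M`, completing the square writes ‖x − y‖² as a function of x,
plus a function of y, plus the form M⁻¹ at y − (M x + c). The first two terms have the same integral
for every transport between fixed marginals; the third is nonnegative and vanishes only when y = M x
+ c. So an affine map with such a linear part is the a.e. unique Monge map onto its image, with no
duality theory (`isMongeMap_affine_and_unique`).

This is used twice. On the marginals, the Bures matrix S satisfies S A_E S = B_E, hence pushes μ_E
to ν_E. On the fibres, linear regression splits X_{E^⊥} = R + K X_E with K = A_{EE^⊥}ᵀ A_E⁻¹, and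
the residual R, uncorrelated with X_E, is independent of it with covariance A/A_E. Each fibre law is
thus a translate of one Gaussian, and with J the regression matrix of B and M the Bures matrix of
the Schur complements, the fibre map is y ↦ M y + (J S − M K) x_E. Inverting S A_E S = B_E
identifies J S − M K with the lower left block. Uniqueness on the marginal and on almost every fibre
is glued along the disintegration. -/

open scoped RealInnerProductSpace

/-! ### Optimality of affine maps for the quadratic cost -/

section Monge

/-- Finite second moments make the cost finite, so costs can be compared as real integrals, where
subtraction is available. -/
lemma lintegral_enorm_sub_sq_eq_ofReal {X : Type*} [NormedAddCommGroup X] [MeasurableSpace X]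
    {α : Measure X} {T : X → X} (hα : MemLp id 2 α)
    (hT : MemLp T 2 α) :
    ∫⁻ x, ‖x - T x‖ₑ ^ 2 ∂α = ENNReal.ofReal (∫ x, ‖x - T x‖ ^ 2 ∂α) := by
  have hint : Integrable (fun x => ‖x - T x‖ ^ 2) α := (hα.sub hT).norm.integrable_sq
  rw [ofReal_integral_eq_lintegral_ofReal hint
    (Filter.Eventually.of_forall fun x => by positivity)]
  refine lintegral_congr fun x => ?_
  rw [ENNReal.ofReal_pow (norm_nonneg _), ofReal_norm]

lemma memLp_two_of_map_eq {X : Type*} [NormedAddCommGroup X] [MeasurableSpace X] [BorelSpace X]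
    [SecondCountableTopology X] {α β : Measure X} {T : X → X} (hβ : MemLp id 2 β)
    (hT : Measurable T) (hmap : α.map T = β) : MemLp T 2 α := by
  subst hmap
  exact (memLp_map_measure_iff (by fun_prop) hT.aemeasurable).1 hβ

variable {X : Type*} [NormedAddCommGroup X] [InnerProductSpace ℝ X]

lemma MeasureTheory.MemLp.integrable_real_inner {Ω : Type*} [MeasurableSpace Ω] {μ : Measure Ω}
    {f g : Ω → X} (hf : MemLp f 2 μ) (hg : MemLp g 2 μ) :
    Integrable (fun ω => ⟪f ω, g ω⟫) μ :=
  (hf.norm.integrable_mul hg.norm).mono' (hf.1.inner hg.1)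
    (Filter.Eventually.of_forall fun _ => norm_inner_le_norm _ _)

/-- Completing the square: up to a function of `x` and a function of `y`, the quadratic cost is the
quadratic form `M⁻¹` evaluated at the deviation of `y` from `M x + c`. -/
lemma norm_sub_sq_eq_add_inner_inverse {M N : X →L[ℝ] X} (hMN : ∀ y, M (N y) = y)
    (hNM : ∀ x, N (M x) = x) (hsymm : ∀ x y, ⟪M x, y⟫ = ⟪x, M y⟫) (c x y : X) :
    ‖x - y‖ ^ 2 = (‖x‖ ^ 2 - ⟪M x, x⟫ - 2 * ⟪c, x⟫) + (‖y‖ ^ 2 - ⟪y - c, N (y - c)⟫) +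
      ⟪y - (M x + c), N (y - (M x + c))⟫ := by
  have h1 : y - (M x + c) = (y - c) - M x := by abel
  have h2 : ⟪M x, N (y - c)⟫ = ⟪x, y - c⟫ := by rw [hsymm, hMN]
  have h3 : ⟪y - c - M x, N (y - c - M x)⟫ =
      ⟪y - c, N (y - c)⟫ - ⟪y - c, x⟫ - (⟪x, y - c⟫ - ⟪M x, x⟫) := by
    rw [N.map_sub (y - c), hNM, inner_sub_left, inner_sub_right, inner_sub_right, h2]
  rw [h1, h3, norm_sub_sq_real, real_inner_comm (y - c) x, inner_sub_left y c x,
    real_inner_comm y x]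
  ring

variable [MeasurableSpace X] [BorelSpace X] [SecondCountableTopology X]

/-- Only the last integral depends on `T`: the function of `T x` integrates against `β` because `T`
pushes `α` to `β`. -/
lemma integral_norm_sub_sq_eq_add_inner_inverse {M N : X →L[ℝ] X} (hMN : ∀ y, M (N y) = y)
    (hNM : ∀ x, N (M x) = x) (hsymm : ∀ x y, ⟪M x, y⟫ = ⟪x, M y⟫) (c : X)
    {α β : Measure X} [IsFiniteMeasure α] [IsFiniteMeasure β]
    (hα : MemLp id 2 α) (hβ : MemLp id 2 β)
    {T : X → X} (hT : Measurable T) (hmap : α.map T = β) :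
    Integrable (fun x => ⟪T x - (M x + c), N (T x - (M x + c))⟫) α ∧
    ∫ x, ‖x - T x‖ ^ 2 ∂α = ∫ x, (‖x‖ ^ 2 - ⟪M x, x⟫ - 2 * ⟪c, x⟫) ∂α +
      ∫ y, (‖y‖ ^ 2 - ⟪y - c, N (y - c)⟫) ∂β +
      ∫ x, ⟪T x - (M x + c), N (T x - (M x + c))⟫ ∂α := by
  have hTm : MemLp T 2 α := memLp_two_of_map_eq hβ hT hmap
  have hMx : MemLp (fun x => M x) 2 α := M.comp_memLp' hα
  have hD : MemLp (fun x => T x - (M x + c)) 2 α := hTm.sub (hMx.add (memLp_const c))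
  have hyc : MemLp (fun y : X => y - c) 2 β := hβ.sub (memLp_const c)
  have h3 : Integrable (fun x => ⟪T x - (M x + c), N (T x - (M x + c))⟫) α :=
    hD.integrable_real_inner (N.comp_memLp' hD)
  have h1 : Integrable (fun x => ‖x‖ ^ 2 - ⟪M x, x⟫ - 2 * ⟪c, x⟫) α :=
    (hα.norm.integrable_sq.sub (hMx.integrable_real_inner hα)).sub
      (((memLp_const c).integrable_real_inner hα).const_mul 2)
  have h2 : Integrable (fun y => ‖y‖ ^ 2 - ⟪y - c, N (y - c)⟫) β :=
    hβ.norm.integrable_sq.sub (hyc.integrable_real_inner (N.comp_memLp' hyc))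
  have h2' : Integrable (fun x => ‖T x‖ ^ 2 - ⟪T x - c, N (T x - c)⟫) α := by
    subst hmap
    exact h2.comp_measurable hT
  refine ⟨h3, ?_⟩
  have h4 : ∫ y, (‖y‖ ^ 2 - ⟪y - c, N (y - c)⟫) ∂β =
      ∫ x, (‖T x‖ ^ 2 - ⟪T x - c, N (T x - c)⟫) ∂α := by
    subst hmap
    exact integral_map hT.aemeasurable h2.1
  have h12 : Integrable (fun x => (‖x‖ ^ 2 - ⟪M x, x⟫ - 2 * ⟪c, x⟫) +
      (‖T x‖ ^ 2 - ⟪T x - c, N (T x - c)⟫)) α := h1.add h2'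
  rw [h4, ← integral_add h1 h2', ← integral_add h12 h3]
  exact integral_congr_ae (Filter.Eventually.of_forall fun x =>
    norm_sub_sq_eq_add_inner_inverse hMN hNM hsymm c x (T x))

/-- An affine map with positive definite symmetric linear part is the unique Monge map between
measures with finite second moments. -/
theorem isMongeMap_affine_and_unique {M N : X →L[ℝ] X} (hMN : ∀ y, M (N y) = y)
    (hNM : ∀ x, N (M x) = x) (hsymm : ∀ x y, ⟪M x, y⟫ = ⟪x, M y⟫)
    (hpos : ∀ v, v ≠ 0 → 0 < ⟪v, N v⟫) (c : X)
    {α β : Measure X} [IsFiniteMeasure α] [IsFiniteMeasure β]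
    (hα : MemLp id 2 α) (hβ : MemLp id 2 β) (hmap : α.map (fun x => M x + c) = β) :
    IsMongeMap α β (fun x => M x + c) ∧
      ∀ T, IsMongeMap α β T → T =ᵐ[α] fun x => M x + c := by
  have hpos' : ∀ v, 0 ≤ ⟪v, N v⟫ := fun v => by
    by_cases hv : v = 0
    · simp [hv]
    · exact (hpos v hv).le
  have hM : Measurable fun x => M x + c := by fun_prop
  have key := fun (T : X → X) (hT : Measurable T) (h : α.map T = β) =>
    integral_norm_sub_sq_eq_add_inner_inverse hMN hNM hsymm c hα hβ hT h
  have hcost := fun (T : X → X) (hT : Measurable T) (h : α.map T = β) =>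
    lintegral_enorm_sub_sq_eq_ofReal hα (memLp_two_of_map_eq hβ hT h)
  have key0 := (key _ hM hmap).2
  simp only [sub_self, map_zero, inner_zero_left, integral_zero, add_zero] at key0
  refine ⟨⟨hM, hmap, fun T hT h => ?_⟩, fun T hT => ?_⟩
  · rw [hcost _ hM hmap, hcost T hT h]
    apply ENNReal.ofReal_le_ofReal
    rw [key0, (key T hT h).2]
    exact le_add_of_nonneg_right (integral_nonneg fun x => hpos' _)
  · have hle := hT.optimal _ hM hmap
    rw [hcost _ hM hmap, hcost T hT.measurable hT.map_eq,
      ENNReal.ofReal_le_ofReal_iff (integral_nonneg fun x => by positivity), key0,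
      (key T hT.measurable hT.map_eq).2] at hle
    -- An optimal `T` costs no more than the affine map, so its nonnegative excess integrates to
    -- zero.
    have h0 := le_antisymm ((add_le_iff_nonpos_right _).1 hle) (integral_nonneg fun x => hpos' _)
    rw [integral_eq_zero_iff_of_nonneg (fun x => hpos' _) (key T hT.measurable hT.map_eq).1] at h0
    filter_upwards [h0] with x hx
    by_contra hne
    exact (hpos _ (sub_ne_zero.2 hne)).ne' hx

end Monge

/-! ### Matrices as operators in orthonormal bases -/

section MatrixCLM

variable {ι κ τ : Type*} [Fintype ι] [DecidableEq ι] [Fintype κ] [Fintype τ]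
  {X Y Z : Type*} [NormedAddCommGroup X] [InnerProductSpace ℝ X] [FiniteDimensional ℝ X]
  [NormedAddCommGroup Y] [InnerProductSpace ℝ Y] [NormedAddCommGroup Z] [InnerProductSpace ℝ Z]

/-- The continuous linear map represented by a matrix in orthonormal bases. -/
noncomputable def matrixCLM (b : OrthonormalBasis ι ℝ X) (c : OrthonormalBasis κ ℝ Y)
    (p : Matrix κ ι ℝ) : X →L[ℝ] Y :=
  LinearMap.toContinuousLinearMap (Matrix.toLin b.toBasis c.toBasis p)

lemma matrixCLM_one (b : OrthonormalBasis ι ℝ X) (x : X) : matrixCLM b b 1 x = x := by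
  simp [matrixCLM]

lemma matrixCLM_add (b : OrthonormalBasis ι ℝ X) (c : OrthonormalBasis κ ℝ Y)
    (p q : Matrix κ ι ℝ) (x : X) :
    matrixCLM b c (p + q) x = matrixCLM b c p x + matrixCLM b c q x := by
  simp [matrixCLM]

lemma matrixCLM_sub (b : OrthonormalBasis ι ℝ X) (c : OrthonormalBasis κ ℝ Y)
    (p q : Matrix κ ι ℝ) (x : X) :
    matrixCLM b c (p - q) x = matrixCLM b c p x - matrixCLM b c q x := by
  simp [matrixCLM]

variable [DecidableEq κ] [FiniteDimensional ℝ Y]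

lemma matrixCLM_mul (b : OrthonormalBasis ι ℝ X) (c : OrthonormalBasis κ ℝ Y)
    (e : OrthonormalBasis τ ℝ Z) (q : Matrix τ κ ℝ) (p : Matrix κ ι ℝ) (x : X) :
    matrixCLM b e (q * p) x = matrixCLM c e q (matrixCLM b c p x) :=
  Matrix.toLin_mul_apply b.toBasis c.toBasis e.toBasis q p x

lemma adjoint_matrixCLM (b : OrthonormalBasis ι ℝ X) (c : OrthonormalBasis κ ℝ Y)
    (p : Matrix κ ι ℝ) :
    ContinuousLinearMap.adjoint (matrixCLM b c p) = matrixCLM c b p.transpose := by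
  ext y
  refine ext_inner_right ℝ fun x => ?_
  rw [ContinuousLinearMap.adjoint_inner_left]
  have h := Matrix.toLin_conjTranspose b c p
  rw [Matrix.conjTranspose_eq_transpose_of_trivial] at h
  simp [matrixCLM, h, LinearMap.adjoint_inner_left]

lemma inner_matrixCLM_self (b : OrthonormalBasis ι ℝ X) (p : Matrix ι ι ℝ) (x : X) :
    ⟪x, matrixCLM b b p x⟫ = dotProduct (b.repr x).ofLp (p.mulVec (b.repr x).ofLp) := by
  have h : (b.repr (matrixCLM b b p x)).ofLp = p.mulVec (b.repr x).ofLp := by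
    have h := LinearMap.toMatrix_mulVec_repr b.toBasis b.toBasis (Matrix.toLin b.toBasis b.toBasis p) x
    rw [LinearMap.toMatrix_toLin] at h
    exact h.symm
  rw [← b.repr.inner_map_map, ← h, PiLp.inner_apply, dotProduct]
  exact Finset.sum_congr rfl fun i _ => by simp [mul_comm]

lemma matrixCLM_basisFun_self (S : Matrix ι ι ℝ) :
    matrixCLM (EuclideanSpace.basisFun ι ℝ) (EuclideanSpace.basisFun ι ℝ) S =
      Matrix.toEuclideanCLM (𝕜 := ℝ) S := rfl

theorem isMongeMap_matrixCLM_and_unique [MeasurableSpace X] [BorelSpace X]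
    (b : OrthonormalBasis ι ℝ X) {S : Matrix ι ι ℝ}
    (hS : S.PosDef) (c : X) {α β : Measure X} [IsGaussian α] [IsGaussian β]
    (hmap : α.map (fun x => matrixCLM b b S x + c) = β) :
    IsMongeMap α β (fun x => matrixCLM b b S x + c) ∧
      ∀ T, IsMongeMap α β T → T =ᵐ[α] fun x => matrixCLM b b S x + c := by
  have hu : IsUnit S.det := (Matrix.isUnit_iff_isUnit_det S).1 hS.isUnit
  refine isMongeMap_affine_and_unique (N := matrixCLM b b S⁻¹) (fun y => ?_) (fun y => ?_)
    (fun x y => ?_) (fun v hv => ?_) c IsGaussian.memLp_two_id IsGaussian.memLp_two_id hmap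
  · rw [← matrixCLM_mul, Matrix.mul_nonsing_inv _ hu, matrixCLM_one]
  · rw [← matrixCLM_mul, Matrix.nonsing_inv_mul _ hu, matrixCLM_one]
  · have hsymm : S.transpose = S := by
      simpa [Matrix.conjTranspose_eq_transpose_of_trivial] using hS.1.eq
    rw [← ContinuousLinearMap.adjoint_inner_right, adjoint_matrixCLM, hsymm]
  · rw [inner_matrixCLM_self]
    have hne : (b.repr v).ofLp ≠ 0 := fun h => hv (by
      rw [← b.repr.map_eq_zero_iff]
      ext i
      exact congrFun h i)
    simpa using hS.inv.dotProduct_mulVec_pos hne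

end MatrixCLM

/-! ### Linear images of centred Gaussians -/

section Gaussian

variable {ι κ τ : Type*} [Fintype ι] [DecidableEq ι] [Fintype κ] [Fintype τ] [DecidableEq τ]
  {Y Z : Type*} [NormedAddCommGroup Y] [InnerProductSpace ℝ Y] [FiniteDimensional ℝ Y]
  [NormedAddCommGroup Z] [InnerProductSpace ℝ Z] [FiniteDimensional ℝ Z]

lemma covariance_inner_matrixCLM_multivariateGaussian {A : Matrix ι ι ℝ} (hA : A.PosSemidef)
    (c : OrthonormalBasis κ ℝ Y) (e : OrthonormalBasis τ ℝ Z)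
    (p : Matrix κ ι ℝ) (q : Matrix τ ι ℝ) (y : Y) (z : Z) :
    cov[fun x => ⟪y, matrixCLM (EuclideanSpace.basisFun ι ℝ) c p x⟫,
      fun x => ⟪z, matrixCLM (EuclideanSpace.basisFun ι ℝ) e q x⟫; multivariateGaussian 0 A] =
      ⟪y, matrixCLM e c (p * A * q.transpose) z⟫ := by
  simp_rw [← ContinuousLinearMap.adjoint_inner_left (matrixCLM _ _ _)]
  rw [← covarianceBilin_apply_eq_cov IsGaussian.memLp_two_id,
    covarianceBilin_multivariateGaussian hA, ← Matrix.inner_toEuclideanCLM,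
    ← matrixCLM_basisFun_self, ContinuousLinearMap.adjoint_inner_left, adjoint_matrixCLM,
    ← matrixCLM_mul, ← matrixCLM_mul, Matrix.mul_assoc,
    ContinuousLinearMap.adjoint_inner_left]

variable [MeasurableSpace Y] [BorelSpace Y]

/-- The two images are jointly Gaussian and `h` says that their cross-covariance vanishes. -/
lemma indepFun_matrixCLM_multivariateGaussian [MeasurableSpace Z] [BorelSpace Z]
    {A : Matrix ι ι ℝ} (hA : A.PosSemidef)
    (c : OrthonormalBasis κ ℝ Y) (e : OrthonormalBasis τ ℝ Z)
    (p : Matrix κ ι ℝ) (q : Matrix τ ι ℝ) (h : p * A * q.transpose = 0) :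
    IndepFun (matrixCLM (EuclideanSpace.basisFun ι ℝ) c p)
      (matrixCLM (EuclideanSpace.basisFun ι ℝ) e q) (multivariateGaussian 0 A) := by
  refine HasGaussianLaw.indepFun_of_covariance_inner ?_ fun y z => ?_
  · exact IsGaussian.hasGaussianLaw_id.map_fun
      ((matrixCLM (EuclideanSpace.basisFun ι ℝ) c p).prod
        (matrixCLM (EuclideanSpace.basisFun ι ℝ) e q))
  · rw [covariance_inner_matrixCLM_multivariateGaussian hA, h]
    simp [matrixCLM]

variable [DecidableEq κ]

/-- Both sides are centred Gaussians, determined by their covariances. -/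
lemma multivariateGaussian_map_matrixCLM_eq {A : Matrix ι ι ℝ} {B : Matrix τ τ ℝ}
    (hA : A.PosSemidef) (hB : B.PosSemidef)
    (c : OrthonormalBasis κ ℝ Y) (p : Matrix κ ι ℝ) (q : Matrix κ τ ℝ)
    (h : p * A * p.transpose = q * B * q.transpose) :
    (multivariateGaussian 0 A).map (matrixCLM (EuclideanSpace.basisFun ι ℝ) c p) =
      (multivariateGaussian 0 B).map (matrixCLM (EuclideanSpace.basisFun τ ℝ) c q) := by
  apply IsGaussian.ext
  · simp only [id_eq]
    rw [ContinuousLinearMap.integral_id_map IsGaussian.integrable_id,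
      ContinuousLinearMap.integral_id_map IsGaussian.integrable_id]
    simp
  · ext u v
    rw [covarianceBilin_apply_eq_cov IsGaussian.memLp_two_id,
      covarianceBilin_apply_eq_cov IsGaussian.memLp_two_id,
      covariance_map (by fun_prop) (by fun_prop) (by fun_prop),
      covariance_map (by fun_prop) (by fun_prop) (by fun_prop)]
    have h1 := covariance_inner_matrixCLM_multivariateGaussian hA c c p p u v
    have h2 := covariance_inner_matrixCLM_multivariateGaussian hB c c q q u v
    rw [h, ← h2] at h1
    exact h1

end Gaussian

/-- If `R` is independent of `X`, the conditional law of `R + f X` given `X = x` is the law of `R`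
translated by `f x`. -/
lemma condDistrib_add_comp_ae_eq_of_indepFun {Ω X Y : Type*} [MeasurableSpace Ω]
    [MeasurableSpace X] [MeasurableSpace Y] [StandardBorelSpace Y] [Nonempty Y] [Add Y]
    [MeasurableAdd₂ Y] {μ : Measure Ω} [IsProbabilityMeasure μ] {U : Ω → X} {R W : Ω → Y}
    (hU : Measurable U) (hR : Measurable R) {f : X → Y} (hf : Measurable f)
    (hind : IndepFun U R μ) (hW : ∀ ω, W ω = R ω + f (U ω)) :
    ∀ᵐ x ∂(μ.map U), condDistrib W U μ x = (μ.map R).map (fun r => r + f x) := by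
  have hg : Measurable fun z : X × Y => z.2 + f z.1 := by fun_prop
  have : IsProbabilityMeasure (μ.map R) := Measure.isProbabilityMeasure_map hR.aemeasurable
  -- Candidate conditional law: draw r from the law of `R` independently of x, then shift by `f x`.
  -- Uniqueness of disintegrations then reduces the claim to the joint law.
  let η : Kernel X Y := (Kernel.id ×ₖ Kernel.const X (μ.map R)).map fun z : X × Y => z.2 + f z.1
  have hη : ∀ x, η x = (μ.map R).map (fun r => r + f x) := fun x => by
    rw [Kernel.map_apply _ hg, Kernel.prod_apply, Kernel.id_apply, Kernel.const_apply,
      Measure.dirac_prod, Measure.map_map hg (by fun_prop)]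
    rfl
  have : IsMarkovKernel η := Kernel.IsMarkovKernel.map _ hg
  have hWm : Measurable W := by
    rw [funext hW]
    fun_prop
  have h : μ.map (fun ω => (U ω, W ω)) = μ.map U ⊗ₘ η := by
    have h1 : μ.map (fun ω => (U ω, W ω)) =
        ((μ.map U).prod (μ.map R)).map (fun z => (z.1, z.2 + f z.1)) := by
      rw [← (indepFun_iff_map_prod_eq_prod_map_map hU.aemeasurable hR.aemeasurable).1 hind,
        Measure.map_map (by fun_prop) (by fun_prop)]
      simp [Function.comp_def, hW]
    rw [h1]
    refine Measure.ext_of_lintegral _ fun F hF => ?_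
    rw [lintegral_map hF (by fun_prop), lintegral_prod _ (by fun_prop),
      Measure.lintegral_compProd hF]
    refine lintegral_congr fun x => ?_
    rw [hη]
    exact (lintegral_map (f := fun y => F (x, y)) (by fun_prop) (by fun_prop)).symm
  filter_upwards [condDistrib_ae_eq_of_measure_eq_compProd_of_measurable hU hWm h] with x hx
  rw [hx, hη]

/-! ### Matrix algebra: Bures–Monge matrix, regression and Schur complement -/

namespace Matrix

lemma PosDef.transpose_eq {n : Type*} {A : Matrix n n ℝ} (hA : A.PosDef) : A.transpose = A := by
  simpa [conjTranspose_eq_transpose_of_trivial] using hA.1.eq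

section Bures

variable {n : Type*} [Fintype n] [DecidableEq n]

lemma PosDef.posDef_cfcSqrt {A : Matrix n n ℝ} (hA : A.PosDef) : (CFC.sqrt A).PosDef := by
  have h0 : (CFC.sqrt A).PosSemidef := nonneg_iff_posSemidef.1 (CFC.sqrt_nonneg A)
  have h1 : CFC.sqrt A * CFC.sqrt A = A := CFC.sqrt_mul_sqrt_self A hA.posSemidef.nonneg
  rw [h0.posDef_iff_isUnit]
  refine isUnit_of_mul_isUnit_left (y := CFC.sqrt A) ?_
  rw [h1]
  exact hA.isUnit

lemma PosDef.mul_mul_same {A R : Matrix n n ℝ} (hA : A.PosDef) (hR : R.PosDef) :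
    (R * A * R).PosDef := by
  have h := hA.conjTranspose_mul_mul_same (B := R)
    (mulVec_injective_of_isUnit hR.isUnit)
  rwa [hR.1.eq] at h

lemma PosDef.buresMonge {A B : Matrix n n ℝ} (hA : A.PosDef) (hB : B.PosDef) :
    (buresMonge A B).PosDef :=
  (hB.mul_mul_same hA.posDef_cfcSqrt).posDef_cfcSqrt.mul_mul_same hA.posDef_cfcSqrt.inv

lemma PosDef.isUnit_det {A : Matrix n n ℝ} (hA : A.PosDef) : IsUnit A.det :=
  (isUnit_iff_isUnit_det A).1 hA.isUnit

/-- This Riccati equation is what makes the Bures matrix push N(0, A) to N(0, B). -/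
lemma PosDef.buresMonge_mul_mul_buresMonge {A B : Matrix n n ℝ} (hA : A.PosDef) (hB : B.PosDef) :
    _root_.buresMonge A B * A * _root_.buresMonge A B = B := by
  have hR := hA.posDef_cfcSqrt.isUnit_det
  have hRR : CFC.sqrt A * CFC.sqrt A = A := CFC.sqrt_mul_sqrt_self A hA.posSemidef.nonneg
  have hWW : CFC.sqrt (CFC.sqrt A * B * CFC.sqrt A) * CFC.sqrt (CFC.sqrt A * B * CFC.sqrt A) =
      CFC.sqrt A * B * CFC.sqrt A :=
    CFC.sqrt_mul_sqrt_self _ (hB.mul_mul_same hA.posDef_cfcSqrt).posSemidef.nonneg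
  rw [_root_.buresMonge]
  generalize CFC.sqrt (CFC.sqrt A * B * CFC.sqrt A) = W at *
  generalize CFC.sqrt A = R at *
  calc R⁻¹ * W * R⁻¹ * A * (R⁻¹ * W * R⁻¹)
      = R⁻¹ * W * (R⁻¹ * R) * (R * R⁻¹) * W * R⁻¹ := by rw [← hRR]; simp only [Matrix.mul_assoc]
    _ = R⁻¹ * (W * W) * R⁻¹ := by
      rw [nonsing_inv_mul _ hR, mul_nonsing_inv _ hR]; simp only [Matrix.mul_assoc, Matrix.one_mul]
    _ = (R⁻¹ * R) * B * (R * R⁻¹) := by rw [hWW]; simp only [Matrix.mul_assoc]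
    _ = B := by rw [nonsing_inv_mul _ hR, mul_nonsing_inv _ hR, Matrix.one_mul, Matrix.mul_one]

end Bures

section Schur

variable {d m n : Type*} [Fintype d]

lemma toBlocks₁₁_transpose_fromCols_mul_mul (P : Matrix d m ℝ) (Q : Matrix d n ℝ)
    (A : Matrix d d ℝ) :
    ((fromCols P Q).transpose * A * fromCols P Q).toBlocks₁₁ = P.transpose * A * P := by
  rw [transpose_fromCols, fromRows_mul, fromRows_mul_fromCols, toBlocks_fromBlocks₁₁]

lemma toBlocks₁₂_transpose_fromCols_mul_mul (P : Matrix d m ℝ) (Q : Matrix d n ℝ)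
    (A : Matrix d d ℝ) :
    ((fromCols P Q).transpose * A * fromCols P Q).toBlocks₁₂ = P.transpose * A * Q := by
  rw [transpose_fromCols, fromRows_mul, fromRows_mul_fromCols, toBlocks_fromBlocks₁₂]

lemma toBlocks₂₂_transpose_fromCols_mul_mul (P : Matrix d m ℝ) (Q : Matrix d n ℝ)
    (A : Matrix d d ℝ) :
    ((fromCols P Q).transpose * A * fromCols P Q).toBlocks₂₂ = Q.transpose * A * Q := by
  rw [transpose_fromCols, fromRows_mul, fromRows_mul_fromCols, toBlocks_fromBlocks₂₂]

variable [Fintype m] [DecidableEq m]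

/-- The matrix `A₂₁ A₁₁⁻¹` of the linear regression of the second block on the first one. -/
noncomputable def regressionMatrix (A : Matrix (m ⊕ n) (m ⊕ n) ℝ) : Matrix n m ℝ :=
  A.toBlocks₁₂.transpose * A.toBlocks₁₁⁻¹

/-- The matrix of the residual of the linear regression, when `P` and `Q` are the matrices of the
two blocks. -/
noncomputable def residualMatrix (P : Matrix d m ℝ) (Q : Matrix d n ℝ) (A : Matrix d d ℝ) :
    Matrix n d ℝ :=
  Q.transpose - regressionMatrix ((fromCols P Q).transpose * A * fromCols P Q) * P.transpose

variable {P : Matrix d m ℝ} {Q : Matrix d n ℝ} {A : Matrix d d ℝ}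

lemma PosDef.transpose_mul_mul_same (hA : A.PosDef) (hP : P.transpose * P = 1) :
    (P.transpose * A * P).PosDef := by
  have h := hA.conjTranspose_mul_mul_same (B := P) fun x y hxy => by
    have h := congrArg (P.transpose.mulVec) hxy
    simpa [mulVec_mulVec, hP] using h
  rwa [conjTranspose_eq_transpose_of_trivial] at h

/-- The normal equations: the regression residual is uncorrelated with the regressor. -/
lemma transpose_mul_mul_residualMatrix_transpose (hA : A.PosDef) (hP : P.transpose * P = 1) :
    P.transpose * A * (residualMatrix P Q A).transpose = 0 := by
  have h := hA.transpose_mul_mul_same hP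
  rw [residualMatrix, regressionMatrix, toBlocks₁₁_transpose_fromCols_mul_mul,
    toBlocks₁₂_transpose_fromCols_mul_mul]
  simp only [transpose_sub, transpose_mul, transpose_transpose, transpose_nonsing_inv,
    hA.transpose_eq, Matrix.mul_sub, Matrix.mul_assoc]
  rw [← Matrix.mul_assoc A P, ← Matrix.mul_assoc P.transpose (A * P),
    ← Matrix.mul_assoc P.transpose A P, mul_nonsing_inv_cancel_left _ _ h.isUnit_det, sub_self]

/-- Since the residual is uncorrelated with the `P` block, one of its two copies may be replaced by
`Q.transpose`. -/
lemma residualMatrix_mul_mul_transpose (hA : A.PosDef) (hP : P.transpose * P = 1) :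
    residualMatrix P Q A * A * (residualMatrix P Q A).transpose =
      schurCompl ((fromCols P Q).transpose * A * fromCols P Q) := by
  have h0 := transpose_mul_mul_residualMatrix_transpose (Q := Q) hA hP
  have h1 : residualMatrix P Q A * A * (residualMatrix P Q A).transpose =
      Q.transpose * A * (residualMatrix P Q A).transpose := by
    conv_lhs => enter [1, 1]; rw [residualMatrix]
    rw [Matrix.sub_mul, Matrix.sub_mul, Matrix.mul_assoc, Matrix.mul_assoc _ P.transpose,
      Matrix.mul_assoc _ (P.transpose * A), h0, Matrix.mul_zero, sub_zero]
  rw [h1, residualMatrix, regressionMatrix, schurCompl, toBlocks₁₁_transpose_fromCols_mul_mul,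
    toBlocks₁₂_transpose_fromCols_mul_mul, toBlocks₂₂_transpose_fromCols_mul_mul]
  simp only [transpose_sub, transpose_mul, transpose_transpose, transpose_nonsing_inv,
    hA.transpose_eq, Matrix.mul_sub, Matrix.mul_assoc]

variable [Fintype n] [DecidableEq n]

/-- The Schur complement is a congruence of `A` by the transposed residual matrix, which is
injective because `Q.transpose` is a left inverse of it. -/
lemma PosDef.schurCompl_transpose_mul_mul (hA : A.PosDef) (hP : P.transpose * P = 1)
    (hQ : Q.transpose * Q = 1) (hPQ : P.transpose * Q = 0) :
    (schurCompl ((fromCols P Q).transpose * A * fromCols P Q)).PosDef := by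
  rw [← residualMatrix_mul_mul_transpose hA hP]
  have h := hA.conjTranspose_mul_mul_same (B := (residualMatrix P Q A).transpose)
    fun x y hxy => by
      have h := congrArg (Q.transpose.mulVec) hxy
      have hQP : Q.transpose * P = 0 := by
        rw [← transpose_transpose (Q.transpose * P), transpose_mul, transpose_transpose, hPQ,
          transpose_zero]
      have h1 : Q.transpose * (residualMatrix P Q A).transpose = 1 := by
        rw [residualMatrix, transpose_sub, transpose_mul, transpose_transpose, transpose_transpose,
          Matrix.mul_sub, ← Matrix.mul_assoc, hQP, hQ, Matrix.zero_mul, sub_zero]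
      simpa [mulVec_mulVec, h1] using h
  rwa [conjTranspose_eq_transpose_of_trivial, transpose_transpose] at h

lemma fromCols_mul_mkMatrix_mul_transpose {B : Matrix d d ℝ} (hA : A.PosDef) (hB : B.PosDef)
    (hP : P.transpose * P = 1) {V : Matrix d (m ⊕ n) ℝ} (hV : V = fromCols P Q)
    {A' B' : Matrix (m ⊕ n) (m ⊕ n) ℝ} (hA' : A' = V.transpose * A * V)
    (hB' : B' = V.transpose * B * V) :
    V * mkMatrix A' B' * V.transpose =
      P * (buresMonge A'.toBlocks₁₁ B'.toBlocks₁₁ * P.transpose) +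
      Q * (buresMonge (schurCompl A') (schurCompl B') * Q.transpose +
        (regressionMatrix B' * buresMonge A'.toBlocks₁₁ B'.toBlocks₁₁ -
          buresMonge (schurCompl A') (schurCompl B') * regressionMatrix A') * P.transpose) := by
  have hA1 : A'.toBlocks₁₁.PosDef := by
    rw [hA', hV, toBlocks₁₁_transpose_fromCols_mul_mul]
    exact hA.transpose_mul_mul_same hP
  have hB1 : B'.toBlocks₁₁.PosDef := by
    rw [hB', hV, toBlocks₁₁_transpose_fromCols_mul_mul]
    exact hB.transpose_mul_mul_same hP
  have hS := hA1.buresMonge hB1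
  -- Inverting S A₁₁ S = B₁₁ and cancelling one factor S.
  have h1 : (buresMonge A'.toBlocks₁₁ B'.toBlocks₁₁)⁻¹ * A'.toBlocks₁₁⁻¹ =
      B'.toBlocks₁₁⁻¹ * buresMonge A'.toBlocks₁₁ B'.toBlocks₁₁ := by
    conv_rhs => enter [1, 1]; rw [← hA1.buresMonge_mul_mul_buresMonge hB1]
    rw [mul_inv_rev, mul_inv_rev, Matrix.mul_assoc, Matrix.mul_assoc,
      nonsing_inv_mul _ hS.isUnit_det, Matrix.mul_one]
  have h2 : (B'.toBlocks₁₂.transpose * (buresMonge A'.toBlocks₁₁ B'.toBlocks₁₁)⁻¹ -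
        buresMonge (schurCompl A') (schurCompl B') * A'.toBlocks₁₂.transpose) * A'.toBlocks₁₁⁻¹ =
      regressionMatrix B' * buresMonge A'.toBlocks₁₁ B'.toBlocks₁₁ -
          buresMonge (schurCompl A') (schurCompl B') * regressionMatrix A' := by
    rw [regressionMatrix, regressionMatrix, Matrix.sub_mul, Matrix.mul_assoc, h1]
    simp only [Matrix.mul_assoc]
  rw [mkMatrix, h2, hV, transpose_fromCols, fromCols_mul_fromBlocks, fromCols_mul_fromRows]
  simp only [Matrix.mul_zero, Matrix.add_mul, Matrix.mul_add, Matrix.mul_assoc, zero_add]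
  abel

end Schur

end Matrix

/-! ### Orthogonal projections and the Gaussian disintegration -/

section Subspace

variable {d k : ℕ} {E : Submodule ℝ (EuclideanSpace ℝ (Fin d))}

lemma matrixCLM_basisMatrix (b : OrthonormalBasis (Fin k) ℝ E) :
    matrixCLM b (EuclideanSpace.basisFun (Fin d) ℝ) (basisMatrix b) = E.subtypeL := by
  apply ContinuousLinearMap.coe_injective
  refine b.toBasis.ext fun j => ?_
  have h := Matrix.toLin_self b.toBasis (EuclideanSpace.basisFun (Fin d) ℝ).toBasis (basisMatrix b) j
  refine h.trans ?_
  have h2 := (EuclideanSpace.basisFun (Fin d) ℝ).sum_repr (b j : EuclideanSpace ℝ (Fin d))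
  simpa [basisMatrix] using h2

lemma matrixCLM_basisMatrix_apply (b : OrthonormalBasis (Fin k) ℝ E) (x : E) :
    matrixCLM b (EuclideanSpace.basisFun (Fin d) ℝ) (basisMatrix b) x = x := by
  rw [matrixCLM_basisMatrix]
  rfl

/-- The projection is the adjoint of the inclusion. -/
lemma orthogonalProjectionOnto_eq_matrixCLM (b : OrthonormalBasis (Fin k) ℝ E) :
    E.orthogonalProjectionOnto =
      matrixCLM (EuclideanSpace.basisFun (Fin d) ℝ) b (basisMatrix b).transpose := by
  rw [← adjoint_matrixCLM, matrixCLM_basisMatrix, ← Submodule.adjoint_orthogonalProjectionOnto,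
    ContinuousLinearMap.adjoint_adjoint]

lemma transpose_basisMatrix_mul_apply {l : ℕ} {F : Submodule ℝ (EuclideanSpace ℝ (Fin d))}
    (b : OrthonormalBasis (Fin k) ℝ E) (c : OrthonormalBasis (Fin l) ℝ F) (i : Fin k)
    (j : Fin l) :
    ((basisMatrix b).transpose * basisMatrix c) i j =
      ⟪(b i : EuclideanSpace ℝ (Fin d)), (c j : EuclideanSpace ℝ (Fin d))⟫ := by
  rw [Matrix.mul_apply, PiLp.inner_apply]
  exact Finset.sum_congr rfl fun x _ => by simp [basisMatrix, mul_comm]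

lemma transpose_basisMatrix_mul_self (b : OrthonormalBasis (Fin k) ℝ E) :
    (basisMatrix b).transpose * basisMatrix b = 1 := by
  ext i j
  rw [transpose_basisMatrix_mul_apply, ← Submodule.coe_inner,
    orthonormal_iff_ite.1 b.orthonormal i j, Matrix.one_apply]

lemma transpose_basisMatrix_mul_orthogonal {l : ℕ} (b : OrthonormalBasis (Fin k) ℝ E)
    (c : OrthonormalBasis (Fin l) ℝ Eᗮ) :
    (basisMatrix b).transpose * basisMatrix c = 0 := by
  ext i j
  rw [transpose_basisMatrix_mul_apply, Matrix.zero_apply]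
  exact Submodule.inner_right_of_mem_orthogonal (b i).2 (c j).2

lemma disintegrationOn_multivariateGaussian_ae_eq {l : ℕ} (b : OrthonormalBasis (Fin k) ℝ E)
    (c : OrthonormalBasis (Fin l) ℝ Eᗮ) {A : Matrix (Fin d) (Fin d) ℝ} (hA : A.PosDef)
    {V : Matrix (Fin d) (Fin k ⊕ Fin l) ℝ}
    (hV : V = Matrix.fromCols (basisMatrix b) (basisMatrix c)) :
    ∀ᵐ x ∂(marginalOn E (multivariateGaussian 0 A)),
      disintegrationOn E (multivariateGaussian 0 A) x =
        ((multivariateGaussian 0 A).map (matrixCLM (EuclideanSpace.basisFun (Fin d) ℝ) c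
          (Matrix.residualMatrix (basisMatrix b) (basisMatrix c) A))).map
          (fun r => r + matrixCLM b c (Matrix.regressionMatrix (V.transpose * A * V)) x) := by
  refine condDistrib_add_comp_ae_eq_of_indepFun (by fun_prop) (by fun_prop) (by fun_prop) ?_
    fun x => ?_
  · rw [orthogonalProjectionOnto_eq_matrixCLM b]
    exact indepFun_matrixCLM_multivariateGaussian hA.posSemidef b c _ _
      (Matrix.transpose_mul_mul_residualMatrix_transpose hA (transpose_basisMatrix_mul_self b))
  · rw [orthogonalProjectionOnto_eq_matrixCLM b, orthogonalProjectionOnto_eq_matrixCLM c,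
      ← matrixCLM_mul, ← matrixCLM_add, Matrix.residualMatrix, hV, sub_add_cancel]

end Subspace

/-! ### The Monge–Knothe map -/

theorem mainTheorem2 {d k l : ℕ} (E : Submodule ℝ (EuclideanSpace ℝ (Fin d)))
    (bE : OrthonormalBasis (Fin k) ℝ E) (bF : OrthonormalBasis (Fin l) ℝ Eᗮ)
    (A B : Matrix (Fin d) (Fin d) ℝ) (hA : A.PosDef) (hB : B.PosDef)
    (V : Matrix (Fin d) (Fin k ⊕ Fin l) ℝ)
    (hV : V = Matrix.fromCols (basisMatrix bE) (basisMatrix bF))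
    (TMK : EuclideanSpace ℝ (Fin d) →ₗ[ℝ] EuclideanSpace ℝ (Fin d))
    (hTMK : TMK = Matrix.toEuclideanLin
      (V * mkMatrix (V.transpose * A * V) (V.transpose * B * V) * V.transpose)) :
    IsMongeKnotheMap E (multivariateGaussian 0 A) (multivariateGaussian 0 B) TMK ∧
    ∀ T : EuclideanSpace ℝ (Fin d) → EuclideanSpace ℝ (Fin d),
      IsMongeKnotheMap E (multivariateGaussian 0 A) (multivariateGaussian 0 B) T →
      T =ᵐ[multivariateGaussian 0 A] TMK := by
  have hP := transpose_basisMatrix_mul_self bE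
  have hQ := transpose_basisMatrix_mul_self bF
  have hPQ := transpose_basisMatrix_mul_orthogonal bE bF
  have hTM := Matrix.fromCols_mul_mkMatrix_mul_transpose hA hB hP hV rfl rfl
  have hA1 := hA.transpose_mul_mul_same hP
  have hB1 := hB.transpose_mul_mul_same hP
  have hA2 := hA.schurCompl_transpose_mul_mul hP hQ hPQ
  have hB2 := hB.schurCompl_transpose_mul_mul hP hQ hPQ
  have hAR := Matrix.residualMatrix_mul_mul_transpose (Q := basisMatrix bF) hA hP
  have hBR := Matrix.residualMatrix_mul_mul_transpose (Q := basisMatrix bF) hB hP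
  rw [← Matrix.toBlocks₁₁_transpose_fromCols_mul_mul _ (basisMatrix bF), ← hV] at hA1 hB1
  rw [← hV] at hA2 hB2 hAR hBR
  have hdA := disintegrationOn_multivariateGaussian_ae_eq bE bF hA hV
  have hdB := disintegrationOn_multivariateGaussian_ae_eq bE bF hB hV
  have hPA : (basisMatrix bE).transpose * A * basisMatrix bE =
      (V.transpose * A * V).toBlocks₁₁ := by
    rw [hV, Matrix.toBlocks₁₁_transpose_fromCols_mul_mul]
  have hPB : (basisMatrix bE).transpose * B * basisMatrix bE =
      (V.transpose * B * V).toBlocks₁₁ := by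
    rw [hV, Matrix.toBlocks₁₁_transpose_fromCols_mul_mul]
  have hSS := hA1.buresMonge_mul_mul_buresMonge hB1
  have hTT := hA2.buresMonge_mul_mul_buresMonge hB2
  have hS := hA1.buresMonge hB1
  have hT := hA2.buresMonge hB2
  generalize buresMonge (V.transpose * A * V).toBlocks₁₁ (V.transpose * B * V).toBlocks₁₁ = S at *
  generalize buresMonge (schurCompl (V.transpose * A * V)) (schurCompl (V.transpose * B * V)) = M
    at *
  generalize Matrix.regressionMatrix (V.transpose * A * V) = K at *
  generalize Matrix.regressionMatrix (V.transpose * B * V) = J at *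
  set μ := multivariateGaussian 0 A
  set ν := multivariateGaussian 0 B
  set e := EuclideanSpace.basisFun (Fin d) ℝ
  have hmarg : ∀ A : Matrix (Fin d) (Fin d) ℝ, marginalOn E (multivariateGaussian 0 A) =
      (multivariateGaussian 0 A).map (matrixCLM e bE (basisMatrix bE).transpose) := fun A => by
    rw [marginalOn, orthogonalProjectionOnto_eq_matrixCLM bE]
  have : IsGaussian (marginalOn E μ) := by rw [hmarg]; infer_instance
  have : IsGaussian (marginalOn E ν) := by rw [hmarg]; infer_instance
  -- the map `S` between the marginals
  have hmapS : (marginalOn E μ).map (fun x => matrixCLM bE bE S x + 0) = marginalOn E ν := by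
    rw [hmarg, hmarg, Measure.map_map (by fun_prop) (by fun_prop)]
    have hcomp : (fun x => matrixCLM bE bE S x + 0) ∘ matrixCLM e bE (basisMatrix bE).transpose =
        matrixCLM e bE (S * (basisMatrix bE).transpose) := by
      ext1 x
      simp [matrixCLM_mul e bE bE]
    rw [hcomp]
    refine multivariateGaussian_map_matrixCLM_eq hA.posSemidef hB.posSemidef bE _ _ ?_
    rw [Matrix.transpose_mul, hS.transpose_eq, Matrix.transpose_transpose, hPB, ← hSS, ← hPA]
    simp only [Matrix.mul_assoc]
  obtain ⟨hSM, hSU⟩ := isMongeMap_matrixCLM_and_unique bE hS 0 hmapS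
  simp only [add_zero] at hSM hSU
  -- the map `M` between the residuals
  have hmapM : ((μ.map (matrixCLM e bF (Matrix.residualMatrix (basisMatrix bE) (basisMatrix bF) A))
      ).map (matrixCLM bF bF M)) =
      ν.map (matrixCLM e bF (Matrix.residualMatrix (basisMatrix bE) (basisMatrix bF) B)) := by
    rw [Measure.map_map (by fun_prop) (by fun_prop)]
    have hcomp : matrixCLM bF bF M ∘
        matrixCLM e bF (Matrix.residualMatrix (basisMatrix bE) (basisMatrix bF) A) =
        matrixCLM e bF (M * Matrix.residualMatrix (basisMatrix bE) (basisMatrix bF) A) := by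
      ext1 x
      simp [matrixCLM_mul e bF bF]
    rw [hcomp]
    refine multivariateGaussian_map_matrixCLM_eq hA.posSemidef hB.posSemidef bF _ _ ?_
    rw [Matrix.transpose_mul, hT.transpose_eq, hBR, ← hTT, ← hAR]
    simp only [Matrix.mul_assoc]
  have hfib : ∀ᵐ x ∂(marginalOn E μ),
      IsMongeMap (disintegrationOn E μ x) (disintegrationOn E ν (matrixCLM bE bE S x))
        (fun z => matrixCLM bF bF M z + matrixCLM bE bF (J * S - M * K) x) ∧
      ∀ T, IsMongeMap (disintegrationOn E μ x) (disintegrationOn E ν (matrixCLM bE bE S x)) T →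
        T =ᵐ[disintegrationOn E μ x]
          fun z => matrixCLM bF bF M z + matrixCLM bE bF (J * S - M * K) x := by
    -- The fibres of ν are known ν_E-a.e.; since S pushes μ_E to ν_E, they are known at S x for
    -- μ_E-almost every x.
    have hdB' := ae_of_ae_map hSM.measurable.aemeasurable (hSM.map_eq.symm ▸ hdB)
    filter_upwards [hdA, hdB'] with x hxA hxB
    rw [hxA, hxB]
    refine isMongeMap_matrixCLM_and_unique bF hT _ ?_
    -- The shift is chosen so that M (r + K x) + (J S − M K) x = M r + J S x.
    have hcomp : (fun z => matrixCLM bF bF M z + matrixCLM bE bF (J * S - M * K) x) ∘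
        (fun r => r + matrixCLM bE bF K x) =
        (fun r => r + matrixCLM bE bF J (matrixCLM bE bE S x)) ∘ matrixCLM bF bF M := by
      funext z
      simp only [Function.comp_apply, map_add, matrixCLM_sub, matrixCLM_mul bE bE bF,
        matrixCLM_mul bE bF bF]
      abel
    rw [← hmapM]
    refine (Measure.map_map (by fun_prop) (by fun_prop)).trans ?_
    rw [hcomp]
    exact (Measure.map_map (by fun_prop) (by fun_prop)).symm
  have hform : ∀ x, TMK x =
      (matrixCLM bE bE S (E.orthogonalProjectionOnto x) : EuclideanSpace ℝ (Fin d)) +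
      (matrixCLM bF bF M (Eᗮ.orthogonalProjectionOnto x) +
        matrixCLM bE bF (J * S - M * K) (E.orthogonalProjectionOnto x) : Eᗮ) := fun x => by
    have h : TMK x = matrixCLM e e
        (V * mkMatrix (V.transpose * A * V) (V.transpose * B * V) * V.transpose) x := by
      rw [hTMK]
      rfl
    rw [h, hTM, matrixCLM_add, matrixCLM_mul e bE e, matrixCLM_mul e bF e,
      matrixCLM_basisMatrix_apply, matrixCLM_basisMatrix_apply, matrixCLM_add,
      matrixCLM_mul e bE bE, matrixCLM_mul e bF bF, matrixCLM_mul e bE bF,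
      ← orthogonalProjectionOnto_eq_matrixCLM, ← orthogonalProjectionOnto_eq_matrixCLM]
  have hTMKm : Measurable TMK := (LinearMap.continuous_of_finiteDimensional TMK).measurable
  refine ⟨⟨hTMKm, _, _, hSM, hfib.mono fun x hx => hx.1, hform⟩, fun T hTK => ?_⟩
  obtain ⟨hTm, S', M', hS', hM', hT'⟩ := hTK
  -- Gluing: the composition-product is the law of (X_E, X_{E^⊥}), so equality on almost every fibre
  -- gives equality μ-a.e. Measurability of `T` makes the equality set measurable.
  have hprod : ∀ᵐ z ∂((marginalOn E μ) ⊗ₘ (disintegrationOn E μ)),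
      T ((z.1 : EuclideanSpace ℝ (Fin d)) + z.2) = TMK ((z.1 : EuclideanSpace ℝ (Fin d)) + z.2) := by
    refine Measure.ae_compProd_of_ae_ae (measurableSet_eq_fun (by fun_prop) (by fun_prop)) ?_
    filter_upwards [hSU S' hS', hM', hfib] with x hx1 hx2 hx3
    -- The fibre maps of `T` target ν at `S' x`, which is S x for almost every x.
    rw [hx1] at hx2
    filter_upwards [hx3.2 _ hx2] with y hy
    rw [hT', hform]
    have h1 : E.orthogonalProjectionOnto ((x : EuclideanSpace ℝ (Fin d)) + y) = x := by
      simp [map_add]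
    have h2 : Eᗮ.orthogonalProjectionOnto ((x : EuclideanSpace ℝ (Fin d)) + y) = y := by
      simp [map_add]
    rw [h1, h2, hx1, hy]
  rw [marginalOn, disintegrationOn, compProd_map_condDistrib (by fun_prop)] at hprod
  filter_upwards [ae_of_ae_map (by fun_prop) hprod] with x hx
  simpa using hx
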